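/- Let $G=(V,E)$ be a finite simple undirected graph. For $X,Y\subseteq V$ let $e(X,Y)$ be the number of edges of $G$ with one endpoint in $X$ and one endpoint in $Y$ (we write $e(x,Y)$ for $e(\{x\},Y)$), and let $G\langle X\rangle$ be the subgraph of $G$ induced by $X$. For disjoint $S,T\subseteq V$ let $oc(S,T)$ be the number of connected components of $G-S-T$ which have an odd number of edges into $T$. A 2-factor of $G$ is a spanning subgraph of $G$ in which every vertex has degree $2$. Lemma 3.2. If $G$ has minimum degree at least $2$ and no 2-factor, then $V$ can be partitioned into (possibly empty) sets $S$, $T$, $O$ and $R$ such that the following properties hold. (i) $T$ is independent. (ii) $e(R,O\cup T)=0$. (iii) Every connected component of $G\langle O\rangle$ has an odd number of edges into $T$. (iv) No $t\in T$ has two edges into the same connected component of $G\langle O\rangle$. (v) For every vertex $o\in O$ we have $e(o,T)\le 1$. (vi) There is no edge $ot\in E$ with $t\in T$, $o\in O$, such that $e(t,S)=0$ and $e(o,O)=0$. (vii) $|T|-|S|-\dfrac{e(T,O)-oc(S,T)}{2}>0$. (Moreover, $oc(S,T)$ is also the number of connected components of $G\langle O\rangle$.) -/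

import Mathlib

namespace GraphFactor

open Classical in
/-- `H` is an `f`-factor of `G`: a spanning subgraph of `G` (a graph on the same vertex set, all of
whose edges are edges of `G`) in which every vertex `v` has degree `f v`. -/
def IsFFactor {V : Type*} [Fintype V] (G : SimpleGraph V) (f : V → ℕ) (H : SimpleGraph V) : Prop :=
  H ≤ G ∧ ∀ v, H.degree v = f v

/-- `G` has a 2-factor: an `f`-factor for the constant function `f = 2`. -/
def HasTwoFactor {V : Type*} [Fintype V] (G : SimpleGraph V) : Prop :=
  ∃ H : SimpleGraph V, IsFFactor G (fun _ => 2) H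

/-- `e(X, Y)`: the number of (unordered) edges of `G` with one endpoint in `X` and one endpoint
in `Y`. -/
noncomputable def e {V : Type*} (G : SimpleGraph V) (X Y : Set V) : ℕ :=
  {a : Sym2 V | a ∈ G.edgeSet ∧ ∃ x ∈ X, ∃ y ∈ Y, a = s(x, y)}.ncard

/-- The vertex set, as a set of vertices of `G`, of a connected component of the subgraph of `G`
induced by `X`. -/
def verts {V : Type*} {G : SimpleGraph V} {X : Set V}
    (C : (G.induce X).ConnectedComponent) : Set V :=
  Subtype.val '' C.supp

/-- `oc(S, T)`: the number of connected components of `G - S - T` with an odd number of edges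
into `T`. -/
noncomputable def oc {V : Type*} (G : SimpleGraph V) (S T : Set V) : ℕ :=
  {C : (G.induce (S ∪ T)ᶜ).ConnectedComponent | Odd (e G (verts C) T)}.ncard

end GraphFactor

namespace GraphFactor

open Finset

set_option linter.unusedSectionVars false

variable {V : Type*} [Fintype V] [DecidableEq V] {G : SimpleGraph V}

section Definitions

variable (G)

/-! The sets come from an extremal violation of Tutte's 2-factor condition. A barrier is a disjoint
pair (S, T) with 2|S| + Σ_{t∈T} deg_{G-S}(t) < 2|T| + oc(S,T). Take O to be the union of the odd
components of G - S - T and R the rest.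

Existence (`exists_barrier`): 2-factors are encoded as perfect matchings of `gadget`. Tutte's
matching theorem gives a violator there; by parity, every vertex of a smallest one sees at least
three components. This forces it to consist of both copies of the vertices of some S and all darts
leaving some T, and counting turns it into a barrier.

Choice: minimise |T|, then maximise |S|, then minimise Σ_{t∈T} deg_{G-S}(t). By parity a barrier has
slack 2, so small changes preserve it. Deleting t from T gives (i), (iv) and the absence of edges
between R and T (`IsBarrier.nb_of_min`); moving o into S gives (v) (`IsBarrier.nb_le_one_of_max`);
swapping t for o in T gives (vi) (`IsBarrier.not_adj_of_extremal`). With (i) and (ii), the barrier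
inequality becomes (vii). -/

/-- `L` is a subset of `U` that no edge of `G` inside `U` leaves. -/
def ClosedIn (U L : Finset V) : Prop :=
  L ⊆ U ∧ ∀ x ∈ L, ∀ y ∈ U, G.Adj x y → y ∈ L

/-- `K` is the vertex set of a connected component of `G` induced on `U`, described as a minimal
nonempty closed subset. -/
def IsComp (U K : Finset V) : Prop :=
  ClosedIn G U K ∧ K.Nonempty ∧ ∀ L ⊆ K, L.Nonempty → ClosedIn G U L → L = K

open Classical in
/-- The component of `x` in `G` induced on `U`. -/
noncomputable def compOf (U : Finset V) (x : V) : Finset V :=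
  univ.filter fun y => ∀ L, ClosedIn G U L → x ∈ L → y ∈ L

open Classical in
/-- All components of `G` induced on `U`. -/
noncomputable def comps (U : Finset V) : Finset (Finset V) :=
  univ.filter (IsComp G U)

open Classical in
/-- The components of `G` induced on `U` of odd total weight. -/
noncomputable def oddComps (U : Finset V) (g : V → ℕ) : Finset (Finset V) :=
  (comps G U).filter fun K => Odd (∑ x ∈ K, g x)

open Classical in
/-- The number of neighbours of `x` in `Y`. -/
noncomputable def nb (x : V) (Y : Finset V) : ℕ :=
  ∑ y ∈ Y, if G.Adj x y then 1 else 0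

/-- The number of adjacent pairs in `X × Y`. -/
noncomputable def adjCount (X Y : Finset V) : ℕ := ∑ x ∈ X, nb G x Y

end Definitions

/-! ### Components as minimal closed sets -/

lemma ClosedIn.inter {U L M : Finset V} (hL : ClosedIn G U L) (hM : ClosedIn G U M) :
    ClosedIn G U (L ∩ M) := by
  refine ⟨inter_subset_left.trans hL.1, fun x hx y hy h => ?_⟩
  rw [mem_inter] at hx ⊢
  exact ⟨hL.2 x hx.1 y hy h, hM.2 x hx.2 y hy h⟩

lemma ClosedIn.sdiff {U L M : Finset V} (hL : ClosedIn G U L) (hM : ClosedIn G U M) :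
    ClosedIn G U (L \ M) := by
  refine ⟨sdiff_subset.trans hL.1, fun x hx y hy h => ?_⟩
  rw [mem_sdiff] at hx ⊢
  exact ⟨hL.2 x hx.1 y hy h, fun h' => hx.2 (hM.2 y h' x (hL.1 hx.1) h.symm)⟩

lemma mem_comps {U K : Finset V} : K ∈ comps G U ↔ IsComp G U K := by simp [comps]

lemma mem_oddComps {U K : Finset V} {g : V → ℕ} :
    K ∈ oddComps G U g ↔ IsComp G U K ∧ Odd (∑ x ∈ K, g x) := by
  simp [oddComps, mem_comps]

lemma IsComp.subset_of_mem {U K L : Finset V} (hK : IsComp G U K) (hL : ClosedIn G U L) {x : V}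
    (hxK : x ∈ K) (hxL : x ∈ L) : K ⊆ L := by
  have := hK.2.2 (K ∩ L) inter_subset_left ⟨x, mem_inter.2 ⟨hxK, hxL⟩⟩ (hK.1.inter hL)
  exact inter_eq_left.1 this

lemma IsComp.eq_of_mem {U K L : Finset V} (hK : IsComp G U K) (hL : IsComp G U L) {x : V}
    (hxK : x ∈ K) (hxL : x ∈ L) : K = L :=
  (hK.subset_of_mem hL.1 hxK hxL).antisymm (hL.subset_of_mem hK.1 hxL hxK)

lemma self_mem_compOf (U : Finset V) (x : V) : x ∈ compOf G U x := by simp [compOf]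

lemma compOf_subset {U L : Finset V} {x : V} (hL : ClosedIn G U L) (hx : x ∈ L) :
    compOf G U x ⊆ L := fun y hy => by
  simp only [compOf, mem_filter, mem_univ, true_and] at hy
  exact hy L hL hx

lemma isComp_compOf {U : Finset V} {x : V} (hx : x ∈ U) : IsComp G U (compOf G U x) := by
  have hU : ClosedIn G U U := ⟨Subset.rfl, fun _ _ _ h _ => h⟩
  have hc : ClosedIn G U (compOf G U x) := by
    refine ⟨compOf_subset hU hx, fun y hy z hz h => ?_⟩
    simp only [compOf, mem_filter, mem_univ, true_and] at hy ⊢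
    exact fun L hL hxL => hL.2 y (hy L hL hxL) z hz h
  refine ⟨hc, ⟨x, self_mem_compOf U x⟩, fun L hLK hne hL => hLK.antisymm ?_⟩
  by_cases hxL : x ∈ L
  · exact compOf_subset hL hxL
  · obtain ⟨y, hy⟩ := hne
    have := compOf_subset (hc.sdiff hL) (mem_sdiff.2 ⟨self_mem_compOf U x, hxL⟩) (hLK hy)
    exact absurd hy (mem_sdiff.1 this).2

lemma IsComp.eq_compOf {U K : Finset V} (hK : IsComp G U K) {x : V} (hx : x ∈ K) :
    K = compOf G U x :=
  hK.eq_of_mem (isComp_compOf (hK.1.1 hx)) hx (self_mem_compOf U x)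

lemma compOf_eq_of_adj {U : Finset V} {x y : V} (hx : x ∈ U) (hy : y ∈ U) (h : G.Adj x y) :
    compOf G U x = compOf G U y :=
  (isComp_compOf hx).eq_compOf ((isComp_compOf hx).1.2 x (self_mem_compOf U x) y hy h)

/-- A component stays a component if the ambient set changes without touching it. -/
lemma IsComp.congr {U U' K : Finset V} (hK : IsComp G U K) (hKU : K ⊆ U')
    (h : ∀ x ∈ K, ∀ y ∈ U', G.Adj x y → y ∈ K) : IsComp G U' K := by
  refine ⟨⟨hKU, h⟩, hK.2.1, fun L hLK hne hL => hK.2.2 L hLK hne ⟨hLK.trans hK.1.1, ?_⟩⟩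
  intro x hx y hy hxy
  exact hL.2 x hx y (hKU (hK.1.2 x (hLK hx) y hy hxy)) hxy

lemma comps_pairwiseDisjoint (U : Finset V) :
    Set.PairwiseDisjoint (comps G U : Set (Finset V)) id := by
  intro K hK L hL hne
  rw [Function.onFun, id, id, Finset.disjoint_left]
  intro x hxK hxL
  exact hne ((mem_comps.1 hK).eq_of_mem (mem_comps.1 hL) hxK hxL)

lemma biUnion_comps (U : Finset V) : (comps G U).biUnion id = U := by
  ext x
  simp only [mem_biUnion, id, mem_comps]
  exact ⟨fun ⟨K, hK, hx⟩ => hK.1.1 hx, fun hx => ⟨_, isComp_compOf hx, self_mem_compOf U x⟩⟩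

lemma sum_comps (U : Finset V) (g : V → ℕ) : ∑ K ∈ comps G U, ∑ x ∈ K, g x = ∑ x ∈ U, g x := by
  conv_rhs => rw [← biUnion_comps (G := G) U]
  rw [sum_biUnion (comps_pairwiseDisjoint U)]
  rfl

/-- The component weights sum to the weight of `U`, so only the odd ones matter modulo 2. This is
the source of every parity gain below. -/
lemma odd_card_oddComps (U : Finset V) (g : V → ℕ) :
    Odd (oddComps G U g).card ↔ Odd (∑ x ∈ U, g x) := by
  classical
  rw [← sum_comps (G := G), Finset.odd_sum_iff_odd_card_odd]
  simp only [oddComps]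

/-- The common tool of all exchange arguments: `B` collects the components that a change of `U` or
`g` may disturb, and at most those are lost. -/
lemma card_oddComps_le {U U' : Finset V} {g g' : V → ℕ} (B : Finset (Finset V))
    (h : ∀ K ∈ oddComps G U g, K ∉ B → IsComp G U' K ∧ ∑ x ∈ K, g' x = ∑ x ∈ K, g x) :
    (oddComps G U g).card ≤ (oddComps G U' g').card + B.card := by
  refine (card_le_card (t := oddComps G U' g' ∪ B) fun K hK => ?_).trans (card_union_le _ _)
  by_cases hB : K ∈ B
  · exact mem_union_right _ hB
  · refine mem_union_left _ ?_
    obtain ⟨h1, h2⟩ := h K hK hB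
    rw [mem_oddComps]
    exact ⟨h1, h2 ▸ (mem_oddComps.1 hK).2⟩

/-! ### Counting adjacent pairs -/

lemma nb_union {x : V} {Y Z : Finset V} (h : Disjoint Y Z) :
    nb G x (Y ∪ Z) = nb G x Y + nb G x Z := sum_union h

lemma nb_eq_zero {x : V} {Y : Finset V} : nb G x Y = 0 ↔ ∀ y ∈ Y, ¬ G.Adj x y := by
  simp [nb]

lemma nb_erase {x t : V} {Y : Finset V} (h : ¬ G.Adj x t) : nb G x (Y.erase t) = nb G x Y := by
  unfold nb
  apply sum_erase
  simp [h]

lemma nb_insert {x t : V} {Y : Finset V} (h : ¬ G.Adj x t) : nb G x (insert t Y) = nb G x Y := by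
  unfold nb
  apply sum_insert_zero
  simp [h]

lemma sum_comps_nb (x : V) (U : Finset V) : ∑ K ∈ comps G U, nb G x K = nb G x U :=
  sum_comps U _

lemma nb_univ (x : V) [Fintype (G.neighborSet x)] : nb G x univ = G.degree x := by
  classical
  simp only [nb, Finset.sum_boole, Nat.cast_id]
  rw [← SimpleGraph.card_neighborFinset_eq_degree]
  congr 1
  ext y
  simp

lemma adjCount_comm (X Y : Finset V) : adjCount G X Y = adjCount G Y X := by
  unfold adjCount nb
  rw [sum_comm]
  exact sum_congr rfl fun x _ => sum_congr rfl fun y _ => by rw [G.adj_comm]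

lemma adjCount_singleton_left (x : V) (Y : Finset V) : adjCount G {x} Y = nb G x Y := by
  simp [adjCount]

lemma adjCount_singleton_right (x : V) (Y : Finset V) : adjCount G Y {x} = nb G x Y := by
  rw [adjCount_comm, adjCount_singleton_left]

lemma adjCount_union_left {X Y Z : Finset V} (h : Disjoint X Y) :
    adjCount G (X ∪ Y) Z = adjCount G X Z + adjCount G Y Z := sum_union h

lemma adjCount_union_right {X Y Z : Finset V} (h : Disjoint Y Z) :
    adjCount G X (Y ∪ Z) = adjCount G X Y + adjCount G X Z := by
  rw [adjCount_comm, adjCount_union_left h, adjCount_comm Y, adjCount_comm Z]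

lemma adjCount_eq_zero {X Y : Finset V} :
    adjCount G X Y = 0 ↔ ∀ x ∈ X, ∀ y ∈ Y, ¬ G.Adj x y := by
  simp [adjCount, nb_eq_zero]

lemma even_adjCount_self (X : Finset V) : Even (adjCount G X X) := by
  induction X using Finset.induction_on with
  | empty => simp [adjCount]
  | insert x X hx ih =>
    have hd : Disjoint {x} X := by simpa using hx
    rw [insert_eq, adjCount_union_left hd, adjCount_union_right hd, adjCount_union_right hd,
      adjCount_singleton_left, adjCount_singleton_left, adjCount_singleton_right]
    have : nb G x {x} = 0 := by simp [nb_eq_zero]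
    rw [this]
    obtain ⟨k, hk⟩ := ih
    exact ⟨nb G x X + k, by omega⟩

/-! ### Barriers and their extremal choice -/

variable (G) in
/-- The pair `(S, T)` violates the condition of Tutte's 2-factor theorem. -/
def IsBarrier (S T : Finset V) : Prop :=
  Disjoint S T ∧
    2 * #S + adjCount G T Sᶜ < 2 * #T + #(oddComps G (S ∪ T)ᶜ fun x => nb G x T)

lemma compl_eq_union_compl_union {S T : Finset V} (h : Disjoint S T) : Sᶜ = T ∪ (S ∪ T)ᶜ := by
  ext x
  have : x ∈ S → x ∉ T := fun hx => Finset.disjoint_left.1 h hx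
  simp only [mem_compl, mem_union]
  tauto

lemma disjoint_compl_union (S T : Finset V) : Disjoint T (S ∪ T)ᶜ := by
  rw [Finset.disjoint_left]
  intro x hx
  simp [hx]

lemma adjCount_compl {S T : Finset V} (h : Disjoint S T) (X : Finset V) :
    adjCount G X Sᶜ = adjCount G X T + adjCount G X (S ∪ T)ᶜ := by
  rw [compl_eq_union_compl_union h, adjCount_union_right (disjoint_compl_union S T)]

lemma nb_compl {S T : Finset V} (h : Disjoint S T) (x : V) :
    nb G x Sᶜ = nb G x T + nb G x (S ∪ T)ᶜ := by
  simpa only [adjCount_singleton_left] using adjCount_compl (G := G) h {x}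

/-- By parity, the inequality defining a barrier has slack. -/
lemma IsBarrier.add_two_le {S T : Finset V} (h : IsBarrier G S T) :
    2 * #S + adjCount G T Sᶜ + 2 ≤ 2 * #T + #(oddComps G (S ∪ T)ᶜ fun x => nb G x T) := by
  obtain ⟨hd, hlt⟩ := h
  have h1 := odd_card_oddComps (G := G) (S ∪ T)ᶜ fun x => nb G x T
  change _ ↔ Odd (adjCount G (S ∪ T)ᶜ T) at h1
  have h2 := even_adjCount_self (G := G) T
  rw [adjCount_comm] at h1
  rw [adjCount_compl hd] at hlt ⊢
  rw [Nat.odd_iff, Nat.odd_iff] at h1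
  rw [Nat.even_iff] at h2
  omega

lemma exists_extremal_barrier {S₀ T₀ : Finset V} (h₀ : IsBarrier G S₀ T₀) :
    ∃ S T, IsBarrier G S T ∧ (∀ S' T', IsBarrier G S' T' → #T ≤ #T') ∧
      (∀ S' T', IsBarrier G S' T' → #T' = #T → #S' ≤ #S) ∧
      (∀ S' T', IsBarrier G S' T' → #T' = #T → #S' = #S →
        adjCount G T Sᶜ ≤ adjCount G T' S'ᶜ) := by
  classical
  obtain ⟨⟨S, T⟩, hmem, hmin⟩ := exists_min_image
    (univ.filter fun p : Finset V × Finset V => IsBarrier G p.1 p.2)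
    -- The complement `Fintype.card V - #p.1` makes a minimum in the second coordinate a maximum of
    -- `#S`.
    (fun p => toLex (#p.2, toLex (Fintype.card V - #p.1, adjCount G p.2 p.1ᶜ)))
    ⟨(S₀, T₀), by simpa using h₀⟩
  simp only [mem_filter, mem_univ, true_and, Prod.forall, Prod.Lex.toLex_le_toLex] at hmem hmin
  refine ⟨S, T, hmem, fun S' T' h => ?_, fun S' T' h hT => ?_, fun S' T' h hT hS => ?_⟩
  all_goals
    have h1 := hmin S' T' h
    have h2 := card_le_univ S
    have h3 := card_le_univ S'
    omega

/-- In a barrier with `T` of minimum size, edges from `t ∈ T` outside `S` go to distinct odd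
components. -/
lemma IsBarrier.nb_of_min {S T : Finset V} (h : IsBarrier G S T)
    (hmin : ∀ S' T', IsBarrier G S' T' → #T ≤ #T') {t : V} (ht : t ∈ T) :
    nb G t T = 0 ∧ ∀ K, IsComp G (S ∪ T)ᶜ K →
      nb G t K ≤ 1 ∧ (¬ Odd (adjCount G K T) → nb G t K = 0) := by
  classical
  have htS : t ∉ S := fun hS => Finset.disjoint_left.1 h.1 hS ht
  set U := (S ∪ T)ᶜ with hU
  set B := (oddComps G U fun x => nb G x T).filter fun K => 0 < nb G t K with hB
  have hU' : (S ∪ T.erase t)ᶜ = insert t U := by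
    ext x
    simp only [hU, mem_compl, mem_union, mem_erase, mem_insert]
    by_cases hx : x = t
    · subst hx; simp [htS]
    · simp [hx]
  have hcard : #(oddComps G U fun x => nb G x T) ≤
      #(oddComps G (insert t U) fun x => nb G x (T.erase t)) + #B := by
    refine card_oddComps_le B fun K hK hKB => ?_
    have hz : nb G t K = 0 := by
      by_contra hne
      exact hKB (mem_filter.2 ⟨hK, Nat.pos_of_ne_zero hne⟩)
    rw [nb_eq_zero] at hz
    have hc := (mem_oddComps.1 hK).1
    refine ⟨hc.congr (hc.1.1.trans (subset_insert _ _)) fun x hx y hy hxy => ?_, ?_⟩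
    · rcases mem_insert.1 hy with rfl | hy
      · exact absurd hxy.symm (hz x hx)
      · exact hc.1.2 x hx y hy hxy
    · exact sum_congr rfl fun x hx => nb_erase fun hxt => hz x hx hxt.symm
  have hnot : ¬ IsBarrier G S (T.erase t) := fun hb => by
    have := hmin _ _ hb
    rw [card_erase_of_mem ht] at this
    have := card_pos.2 ⟨t, ht⟩
    omega
  have hgap := h.add_two_le
  rw [← hU] at hgap
  have hTe : adjCount G T Sᶜ = adjCount G (T.erase t) Sᶜ + nb G t Sᶜ := by
    rw [adjCount, adjCount, sum_erase_add _ _ ht]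
  -- Deleting `t` costs 2 from `2 * #T`, paid by the slack, and at most `#B` odd components. Were
  -- the degree of `t` outside `S` larger than `#B`, a smaller barrier would result.
  have hle : nb G t Sᶜ ≤ #B := by
    by_contra hlt
    refine hnot ⟨h.1.mono_right (erase_subset _ _), ?_⟩
    rw [hU', card_erase_of_mem ht]
    have := card_pos.2 ⟨t, ht⟩
    omega
  have hsub : B ⊆ comps G U := fun K hK =>
    mem_comps.2 (mem_oddComps.1 (mem_filter.1 hK).1).1
  have hsum : ∑ K ∈ comps G U, nb G t K = nb G t U := sum_comps_nb t U
  rw [nb_compl h.1, ← hU, ← hsum] at hle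
  have hBc : #B = ∑ K ∈ comps G U, if K ∈ B then 1 else 0 := by
    rw [sum_boole, Nat.cast_id, filter_mem_eq_inter, inter_eq_right.2 hsub]
  -- The reverse inequality holds termwise, so equality holds in every term and nothing is left for
  -- neighbours in `T`.
  have hpt : ∀ K ∈ comps G U, (if K ∈ B then 1 else 0) ≤ nb G t K := by
    intro K _
    split_ifs with hK
    · exact (mem_filter.1 hK).2
    · exact Nat.zero_le _
  have hge := sum_le_sum hpt
  refine ⟨by omega, fun K hK => ?_⟩
  have heq := (sum_eq_sum_iff_of_le hpt).1 (by omega) K (mem_comps.2 hK)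
  refine ⟨by rw [← heq]; split_ifs <;> simp, fun hodd => ?_⟩
  rw [← heq, if_neg]
  exact fun hKB => hodd (mem_oddComps.1 (mem_filter.1 hKB).1).2

/-- In a barrier with `T` of minimum size and then `S` of maximum size, every outside vertex has at
most one neighbour in `T`. -/
lemma IsBarrier.nb_le_one_of_max {S T : Finset V} (h : IsBarrier G S T)
    (hmax : ∀ S' T', IsBarrier G S' T' → #T' = #T → #S' ≤ #S) {o : V} (ho : o ∈ (S ∪ T)ᶜ) :
    nb G o T ≤ 1 := by
  by_contra! hlt
  have hoS : o ∉ S := fun hS => by simp [hS] at ho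
  have hoT : o ∉ T := fun hT => by simp [hT] at ho
  have hgap := h.add_two_le
  have hcard : #(oddComps G (S ∪ T)ᶜ fun x => nb G x T) ≤
      #(oddComps G (insert o S ∪ T)ᶜ fun x => nb G x T) + #{compOf G (S ∪ T)ᶜ o} := by
    refine card_oddComps_le _ fun K hK hKB => ⟨?_, rfl⟩
    have hc := (mem_oddComps.1 hK).1
    have hoK : o ∉ K := fun hoK => hKB (mem_singleton.2 (hc.eq_compOf hoK))
    have hU : (insert o S ∪ T)ᶜ = (S ∪ T)ᶜ.erase o := by
      ext x
      simp only [mem_compl, mem_union, mem_insert, mem_erase]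
      tauto
    rw [hU]
    exact hc.congr (fun x hx => mem_erase.2 ⟨fun hxo => hoK (hxo ▸ hx), hc.1.1 hx⟩)
      fun x hx y hy hxy => hc.1.2 x hx y (mem_of_mem_erase hy) hxy
  rw [card_singleton] at hcard
  have hSe : adjCount G T Sᶜ = adjCount G T (insert o S)ᶜ + nb G o T := by
    have : Sᶜ = (insert o S)ᶜ ∪ {o} := by
      ext x
      simp only [mem_compl, mem_union, mem_insert, mem_singleton]
      by_cases hx : x = o
      · subst hx; simp [hoS]
      · simp [hx]
    rw [this, adjCount_union_right (by simp), adjCount_singleton_right]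
  -- `2 * #S` grows by 2, the degree sum drops by at least 2, and at most the component of `o` is
  -- lost: the slack covers this.
  have hb : IsBarrier G (insert o S) T := by
    refine ⟨disjoint_insert_left.2 ⟨hoT, h.1⟩, ?_⟩
    rw [card_insert_of_notMem hoS]
    omega
  have := hmax _ _ hb rfl
  rw [card_insert_of_notMem hoS] at this
  omega

/-- Exchange argument: in an extremal barrier no leaf component `{o}` hangs at a vertex `t ∈ T` that
has at least two neighbours outside `S`. -/
lemma IsBarrier.not_adj_of_extremal {S T : Finset V} (h : IsBarrier G S T)
    (hmin : ∀ S' T', IsBarrier G S' T' → #T' = #T → #S' = #S →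
        adjCount G T Sᶜ ≤ adjCount G T' S'ᶜ) {o t : V} (ho : o ∈ (S ∪ T)ᶜ) (ht : t ∈ T)
    (hoT : nb G o T = 1) (hoU : nb G o (S ∪ T)ᶜ = 0) (htS : 2 ≤ nb G t Sᶜ) (htT : nb G t T = 0) :
    ¬ G.Adj o t := by
  classical
  intro hadj
  have hoS : o ∉ S := fun hS => by simp [hS] at ho
  have hoT' : o ∉ T := fun hT => by simp [hT] at ho
  have htS' : t ∉ S := fun hS => Finset.disjoint_left.1 h.1 hS ht
  have hot : o ≠ t := hadj.ne
  have hgap := h.add_two_le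
  set U := (S ∪ T)ᶜ with hU
  set T' := insert o (T.erase t) with hT'
  have hcT : #T' = #T := by
    rw [hT', card_insert_of_notMem (by simp [hoT']), card_erase_of_mem ht]
    have := card_pos.2 ⟨t, ht⟩
    omega
  have hdis : Disjoint S T' :=
    disjoint_insert_right.2 ⟨hoS, h.1.mono_right (erase_subset _ _)⟩
  have hU' : (S ∪ T')ᶜ = insert t (U.erase o) := by
    ext x
    simp only [hU, hT', mem_compl, mem_union, mem_erase, mem_insert]
    by_cases hx : x = t
    · subst hx; simp [htS', hot.symm]
    · simp only [hx]; tauto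
  have hsum : adjCount G T' Sᶜ + nb G t Sᶜ = adjCount G T Sᶜ + 1 := by
    have h1 : adjCount G T Sᶜ = adjCount G (T.erase t) Sᶜ + nb G t Sᶜ := by
      rw [adjCount, adjCount, sum_erase_add _ _ ht]
    have h2 : adjCount G T' Sᶜ = nb G o Sᶜ + adjCount G (T.erase t) Sᶜ := by
      rw [adjCount, adjCount, hT', sum_insert (by simp [hoT'])]
    have h3 : nb G o Sᶜ = 1 := by rw [nb_compl h.1, ← hU, hoT, hoU]
    omega
  -- The component of `o` is in `B` as well, since `o` is adjacent to `t`.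
  set B := (comps G U).filter fun K => 0 < nb G t K with hB
  have hBle : #B ≤ nb G t Sᶜ := by
    rw [nb_compl h.1, htT, zero_add, ← hU, ← sum_comps_nb t U, card_eq_sum_ones]
    exact (sum_le_sum fun K hK => (mem_filter.1 hK).2).trans
      (sum_le_sum_of_subset (filter_subset _ _))
  have hcard : #(oddComps G U fun x => nb G x T) ≤
      #(oddComps G (S ∪ T')ᶜ fun x => nb G x T') + #B := by
    refine card_oddComps_le B fun K hK hKB => ?_
    have hc := (mem_oddComps.1 hK).1
    have hz : nb G t K = 0 := by
      by_contra hne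
      exact hKB (mem_filter.2 ⟨mem_comps.2 hc, Nat.pos_of_ne_zero hne⟩)
    rw [nb_eq_zero] at hz
    have hoK : o ∉ K := fun hoK => hz o hoK hadj.symm
    rw [hU']
    refine ⟨hc.congr (fun x hx => mem_insert_of_mem (mem_erase.2
      ⟨fun hxo => hoK (hxo ▸ hx), hc.1.1 hx⟩)) fun x hx y hy hxy => ?_, ?_⟩
    · rcases mem_insert.1 hy with rfl | hy
      · exact absurd hxy.symm (hz x hx)
      · exact hc.1.2 x hx y (mem_of_mem_erase hy) hxy
    · refine sum_congr rfl fun x hx => ?_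
      rw [hT', nb_insert fun hxo => ?_, nb_erase fun hxt => hz x hx hxt.symm]
      exact nb_eq_zero.1 hoU x (hc.1.1 hx) hxo.symm
  -- The degree sum changes by `1 - nb G t Sᶜ` and at most `nb G t Sᶜ` odd components are lost: a
  -- net cost of 1, within the slack. As `nb G t Sᶜ` is at least 2, the degree sum strictly
  -- decreases, against `hmin`.
  have hb : IsBarrier G S T' := ⟨hdis, by omega⟩
  have := hmin _ _ hb hcT rfl
  omega

/-! ### Comparison with Mathlib's components, and Tutte violators -/

/-- Connected components in the sense of Mathlib, of a graph embedded as the induced subgraph on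
`U`, correspond to components in the sense of `IsComp`. -/
lemma exists_equiv_isComp {A : Type*} (H : SimpleGraph A) {φ : A → V} (hφ : φ.Injective)
    (hadj : ∀ a b, H.Adj a b ↔ G.Adj (φ a) (φ b)) {U : Finset V} (hU : ∀ v, v ∈ U ↔ ∃ a, φ a = v) :
    ∃ F : H.ConnectedComponent ≃ {K // IsComp G U K},
      ∀ C, ((F C : Finset V) : Set V) = φ '' C.supp := by
  classical
  let f : H.ConnectedComponent → Finset V := fun C => univ.filter (· ∈ φ '' C.supp)
  have hf : ∀ C, (f C : Set V) = φ '' C.supp := fun C => by ext; simp [f]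
  have hmem : ∀ C a, φ a ∈ f C ↔ H.connectedComponentMk a = C := fun C a => by
    rw [← mem_coe, hf, hφ.mem_set_image, SimpleGraph.ConnectedComponent.mem_supp_iff]
  have hsub : ∀ C, f C ⊆ U := fun C v hv => by
    rw [← mem_coe, hf] at hv
    obtain ⟨a, -, rfl⟩ := hv
    exact (hU _).2 ⟨a, rfl⟩
  have hreach : ∀ L, ClosedIn G U L → ∀ a b, H.Reachable a b → φ a ∈ L → φ b ∈ L := by
    rintro L hL a b ⟨p⟩
    induction p with
    | nil => exact id
    | cons h _ ih => exact fun ha => ih (hL.2 _ ha _ ((hU _).2 ⟨_, rfl⟩) ((hadj _ _).1 h))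
  have hcomp : ∀ C, IsComp G U (f C) := by
    intro C
    refine ⟨⟨hsub C, fun x hx y hy hxy => ?_⟩, ?_, fun L hLK hne hL => hLK.antisymm fun y hy => ?_⟩
    · obtain ⟨a, rfl⟩ := (hU x).1 (hsub C hx)
      obtain ⟨b, rfl⟩ := (hU y).1 hy
      rw [hmem] at hx ⊢
      rw [← hx]
      exact SimpleGraph.ConnectedComponent.sound ((hadj _ _).2 hxy).symm.reachable
    · obtain ⟨a, ha⟩ := C.exists_rep
      exact ⟨φ a, (hmem _ _).2 ha⟩
    · obtain ⟨x, hx⟩ := hne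
      obtain ⟨a, rfl⟩ := (hU x).1 (hL.1 hx)
      obtain ⟨b, rfl⟩ := (hU y).1 (hsub C hy)
      have ha := (hmem _ _).1 (hLK hx)
      rw [hmem, ← ha] at hy
      exact hreach L hL a b (SimpleGraph.ConnectedComponent.exact hy).symm hx
  refine ⟨Equiv.ofBijective (fun C => ⟨f C, hcomp C⟩) ⟨fun C D h => ?_, fun ⟨K, hK⟩ => ?_⟩, hf⟩
  · have h : f C = f D := congrArg Subtype.val h
    obtain ⟨a, ha⟩ := C.exists_rep
    have h1 : φ a ∈ f C := (hmem _ _).2 ha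
    rw [h, hmem] at h1
    exact ha.symm.trans h1
  · obtain ⟨x, hx⟩ := hK.2.1
    obtain ⟨a, rfl⟩ := (hU x).1 (hK.1.1 hx)
    exact ⟨H.connectedComponentMk a, Subtype.ext
      ((hcomp _).eq_of_mem hK ((hmem _ _).2 rfl) hx)⟩

/-- An arbitrary embedding `φ` lets this serve both the vertex-deleted subgraph of Tutte's theorem
and the induced subgraph in `oc`. -/
lemma ncard_components_eq_card_oddComps {A : Type*} (H : SimpleGraph A) {φ : A → V}
    (hφ : φ.Injective) (hadj : ∀ a b, H.Adj a b ↔ G.Adj (φ a) (φ b)) {U : Finset V}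
    (hU : ∀ v, v ∈ U ↔ ∃ a, φ a = v) (P : H.ConnectedComponent → Prop) (g : V → ℕ)
    (hP : ∀ C (K : Finset V), (K : Set V) = φ '' C.supp → (P C ↔ Odd (∑ x ∈ K, g x))) :
    {C | P C}.ncard = #(oddComps G U g) := by
  classical
  obtain ⟨F, hF⟩ := exists_equiv_isComp H hφ hadj hU
  rw [← Set.ncard_coe_finset]
  refine Set.ncard_congr (fun C _ => (F C : Finset V)) (fun C hC => ?_) (fun C D _ _ h => ?_)
    fun K hK => ?_
  · exact mem_coe.2 (mem_oddComps.2 ⟨(F C).2, (hP C _ (hF C)).1 hC⟩)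
  · exact F.injective (Subtype.ext h)
  · obtain ⟨h1, h2⟩ := mem_oddComps.1 (mem_coe.1 hK)
    refine ⟨F.symm ⟨K, h1⟩, ?_, by simp⟩
    refine (hP _ K ?_).2 h2
    rw [← hF, Equiv.apply_symm_apply]

/-- If `G` has no perfect matching, then it has a Tutte violator, in terms of `oddComps`. -/
lemma exists_card_lt_card_oddComps (h : ¬ ∃ M : G.Subgraph, M.IsPerfectMatching) :
    ∃ X : Finset V, #X < #(oddComps G Xᶜ fun _ => 1) := by
  classical
  rw [SimpleGraph.tutte] at h
  push Not at h
  obtain ⟨u, hu⟩ := h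
  refine ⟨univ.filter (· ∈ u), ?_⟩
  have hX : (((univ.filter (· ∈ u) : Finset V)) : Set V) = u := by ext; simp
  rw [← Set.ncard_coe_finset, hX]
  refine hu.trans_eq ?_
  refine ncard_components_eq_card_oddComps _ (φ := Subtype.val) Subtype.val_injective ?_ ?_ _ _ ?_
  · rintro ⟨a, ha⟩ ⟨b, hb⟩
    have ha' : a ∉ u := ha.2
    have hb' : b ∉ u := hb.2
    simp [ha', hb']
  · intro v
    simp
  · intro C K hK
    rw [← card_eq_sum_ones, ← Set.ncard_coe_finset, hK,
      Set.ncard_image_of_injective _ Subtype.val_injective]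

/-- If the number of vertices is even and there is no perfect matching, there is a Tutte violator
such that each of its vertices sees at least three components outside. -/
lemma exists_minimal_violator (h : ¬ ∃ M : G.Subgraph, M.IsPerfectMatching)
    (heven : Even (Fintype.card V)) :
    ∃ X : Finset V, #X < #(oddComps G Xᶜ fun _ => 1) ∧
      ∀ x ∈ X, ∀ B : Finset (Finset V), (∀ y, y ∉ X → G.Adj x y → compOf G Xᶜ y ∈ B) → 3 ≤ #B := by
  classical
  obtain ⟨X, hX, hmin⟩ := exists_min_image
    (univ.filter fun X : Finset V => #X < #(oddComps G Xᶜ fun _ => 1)) card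
    (by obtain ⟨X, hX⟩ := exists_card_lt_card_oddComps h; exact ⟨X, by simpa using hX⟩)
  simp only [mem_filter, mem_univ, true_and] at hX hmin
  refine ⟨X, hX, fun x hx B hB => ?_⟩
  by_contra! hlt
  -- As the order is even, `#X` and the number of odd components have equal parity, so they differ
  -- by at least 2. If `x` sees at most two components, `X.erase x` is still a violator.
  have hpar := odd_card_oddComps (G := G) Xᶜ fun _ => 1
  rw [← card_eq_sum_ones, card_compl] at hpar
  have hXle := card_le_univ X
  have hcard : #(oddComps G Xᶜ fun _ => 1) ≤ #(oddComps G (X.erase x)ᶜ fun _ => 1) + #B := by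
    refine card_oddComps_le B fun K hK hKB => ⟨?_, rfl⟩
    have hc := (mem_oddComps.1 hK).1
    rw [compl_erase]
    refine hc.congr (hc.1.1.trans (subset_insert _ _)) fun y hy z hz hyz => ?_
    rcases mem_insert.1 hz with rfl | hz
    · refine absurd ?_ hKB
      rw [hc.eq_compOf hy]
      exact hB y (mem_compl.1 (hc.1.1 hy)) hyz.symm
    · exact hc.1.2 y hy z hz hyz
  have hpos := card_pos.2 ⟨x, hx⟩
  have hcX := card_erase_of_mem hx
  rw [Nat.odd_iff, Nat.odd_iff] at hpar
  rw [Nat.even_iff] at heven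
  have := hmin (X.erase x) (by omega)
  omega

/-! ### The gadget graph and the existence of a barrier -/

variable (G) in
/-- The gadget graph: two copies of each vertex `v` of `G` and one vertex for each dart of `G`;
both copies of `v` are joined to all darts leaving `v`, and each dart is joined to its reversal. Its
perfect matchings encode the 2-factors of `G`. -/
def gadget : SimpleGraph ((V × Bool) ⊕ G.Dart) where
  Adj
    | .inl _, .inl _ => False
    | .inl p, .inr d => d.fst = p.1
    | .inr d, .inl p => d.fst = p.1
    | .inr d, .inr d' => d' = d.symm
  symm := ⟨by
    rintro (p | d) (q | d') h
    · exact h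
    · exact h
    · exact h
    · exact (SimpleGraph.Dart.symm_symm d).symm.trans (congrArg SimpleGraph.Dart.symm h).symm⟩
  loopless := ⟨by
    rintro (p | d) h
    · exact h
    · exact d.symm_ne h.symm⟩

@[simp] lemma gadget_adj_inl_inl (p q : V × Bool) : ¬ (gadget G).Adj (.inl p) (.inl q) := id

@[simp] lemma gadget_adj_inl_inr (p : V × Bool) (d : G.Dart) :
    (gadget G).Adj (.inl p) (.inr d) ↔ d.fst = p.1 := Iff.rfl

@[simp] lemma gadget_adj_inr_inl (p : V × Bool) (d : G.Dart) :
    (gadget G).Adj (.inr d) (.inl p) ↔ d.fst = p.1 := Iff.rfl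

/-- The two copies of `v` are matched to two distinct darts leaving `v`; every other dart at `v` is
matched to its reversal. So the edges whose darts are not matched to each other give degree 2
everywhere. -/
lemma hasTwoFactor_of_gadget {M : (gadget G).Subgraph} (hM : M.IsPerfectMatching) :
    HasTwoFactor G := by
  classical
  have hex : ∀ w, ∃! w', M.Adj w w' := fun w => hM.1 (hM.2 w)
  have hp : ∀ q : V × Bool, ∃ d : G.Dart, d.fst = q.1 ∧ M.Adj (.inl q) (.inr d) := by
    intro q
    obtain ⟨w, hw, -⟩ := hex (.inl q)
    rcases w with p | d
    · exact absurd hw.adj_sub (gadget_adj_inl_inl _ _)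
    · exact ⟨d, hw.adj_sub, hw⟩
  choose p hp1 hp2 using hp
  let H : SimpleGraph V :=
    { Adj := fun u v => ∃ h : G.Adj u v, ¬ M.Adj (.inr ⟨(u, v), h⟩) (.inr ⟨(v, u), h.symm⟩)
      symm := ⟨fun u v ⟨h, h'⟩ => ⟨h.symm, fun h'' => h' h''.symm⟩⟩
      loopless := ⟨fun u ⟨h, _⟩ => h.ne rfl⟩ }
  have hH : ∀ v w, H.Adj v w ↔ ∃ i, (p (v, i)).snd = w := by
    intro v w
    constructor
    · rintro ⟨h, hn⟩
      obtain ⟨x, hx, -⟩ := hex (.inr ⟨(v, w), h⟩)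
      rcases x with ⟨v', i⟩ | d
      · obtain rfl : v = v' := hx.adj_sub
        have := (hex (.inl (v, i))).unique hx.symm (hp2 (v, i))
        exact ⟨i, by rw [← Sum.inr_injective this]⟩
      · have h1 : d = _ := hx.adj_sub
        subst h1
        exact absurd hx hn
    · rintro ⟨i, rfl⟩
      have h1 := hp1 (v, i)
      have h2 := hp2 (v, i)
      generalize p (v, i) = d at h1 h2
      obtain ⟨⟨a, b⟩, hab⟩ := d
      obtain rfl : a = v := h1
      refine ⟨hab, fun h3 => ?_⟩
      have := (hex _).unique h2.symm h3
      cases this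
  refine ⟨H, fun u v h => h.1, fun v => ?_⟩
  have hinj : Function.Injective fun i => (p (v, i)).snd := by
    intro i j hij
    have hd : p (v, i) = p (v, j) := by
      apply SimpleGraph.Dart.ext
      exact Prod.ext ((hp1 (v, i)).trans (hp1 (v, j)).symm) hij
    have h1 := hp2 (v, i)
    rw [hd] at h1
    have := (hex _).unique h1.symm (hp2 (v, j)).symm
    simpa using this
  rw [← SimpleGraph.card_neighborFinset_eq_degree]
  trans #(univ.image fun i => (p (v, i)).snd)
  · congr 1
    ext w
    rw [SimpleGraph.mem_neighborFinset, hH]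
    simp only [mem_image, mem_univ, true_and]
  · rw [card_image_of_injective _ hinj]
    rfl

lemma card_darts_eq_adjCount [DecidableRel G.Adj] (A B : Finset V) :
    #(univ.filter fun d : G.Dart => d.fst ∈ A ∧ d.snd ∈ B) = adjCount G A B := by
  classical
  have h : adjCount G A B = #((A ×ˢ B).filter fun p => G.Adj p.1 p.2) := by
    rw [card_filter, sum_product]
    simp only [adjCount, nb]
    congr! 3
  rw [h]
  refine card_bij (fun d _ => d.toProd) (fun d hd => ?_) (fun d _ d' _ h => ?_) fun p hp => ?_
  · simp only [mem_filter, mem_univ, true_and] at hd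
    simp [hd]
  · exact SimpleGraph.Dart.ext _ _ h
  · simp only [mem_filter, mem_product] at hp
    exact ⟨⟨p, hp.2⟩, by simpa using hp.1, rfl⟩

/-- The set of vertices of the gadget graph that belongs to a component `K` outside `S ∪ T`. -/
def gadgetLift [DecidableRel G.Adj] (S K : Finset V) : Finset ((V × Bool) ⊕ G.Dart) :=
  (K ×ˢ univ).disjSum (univ.filter fun d => d.fst ∈ K ∨ d.fst ∈ S ∧ d.snd ∈ K)

lemma inl_mem_gadgetLift [DecidableRel G.Adj] {S K : Finset V} {p : V × Bool} :
    .inl p ∈ gadgetLift (G := G) S K ↔ p.1 ∈ K := by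
  simp [gadgetLift]

lemma inr_mem_gadgetLift [DecidableRel G.Adj] {S K : Finset V} {d : G.Dart} :
    .inr d ∈ gadgetLift (G := G) S K ↔ d.fst ∈ K ∨ d.fst ∈ S ∧ d.snd ∈ K := by
  simp [gadgetLift]

/-- The size is 2|K| plus the darts leaving `K` plus those from `S` to `K`. Darts between `S` and
`K` occur in both directions and darts inside `K` pair up, so modulo 2 only those from `K` to `T`
remain. -/
lemma IsComp.odd_card_gadgetLift [DecidableRel G.Adj] {S T K : Finset V} (hd : Disjoint S T)
    (hK : IsComp G (S ∪ T)ᶜ K) :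
    Odd #(gadgetLift (G := G) S K) ↔ Odd (∑ x ∈ K, nb G x T) := by
  have hKS : Disjoint K S := by
    rw [Finset.disjoint_left]
    intro x hx hxS
    have := hK.1.1 hx
    simp [hxS] at this
  have h1 : #(gadgetLift (G := G) S K) = #K * 2 + (adjCount G K univ + adjCount G S K) := by
    rw [gadgetLift, card_disjSum, card_product, ← card_darts_eq_adjCount,
      ← card_darts_eq_adjCount, ← card_union_of_disjoint, ← filter_or]
    · simp
    · rw [Finset.disjoint_left]
      intro d h1 h2
      simp only [mem_filter, mem_univ, true_and, and_true] at h1 h2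
      exact Finset.disjoint_left.1 hKS h1 h2.1
  have h2 : adjCount G K univ = adjCount G S K + (adjCount G K T + adjCount G K (S ∪ T)ᶜ) := by
    rw [← adjCount_compl hd, adjCount_comm S, ← adjCount_union_right disjoint_compl_right,
      union_compl]
  have h3 : adjCount G K (S ∪ T)ᶜ = adjCount G K K := by
    conv_lhs => rw [← union_sdiff_of_subset hK.1.1]
    rw [adjCount_union_right disjoint_sdiff, Nat.add_eq_left, adjCount_eq_zero]
    intro x hx y hy hxy
    rw [mem_sdiff] at hy
    exact hy.2 (hK.1.2 x hx y hy.1 hxy)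
  have h4 := even_adjCount_self (G := G) K
  change _ ↔ Odd (adjCount G K T)
  rw [h1, h2, h3, Nat.odd_iff, Nat.odd_iff]
  rw [Nat.even_iff] at h4
  omega

lemma gadget_adj_inr {d : G.Dart} {y : (V × Bool) ⊕ G.Dart} (h : (gadget G).Adj (.inr d) y) :
    y = .inl (d.fst, false) ∨ y = .inl (d.fst, true) ∨ y = .inr d.symm := by
  rcases y with ⟨v, _ | _⟩ | d'
  · obtain rfl : d.fst = v := h
    simp
  · obtain rfl : d.fst = v := h
    simp
  · obtain rfl : d' = d.symm := h
    simp

/-- Every odd component of the gadget graph outside the set `X` determined by `S` and `T` is a copy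
of a vertex of `T`, a dart from `S` to `T`, or comes from an odd component of `G`. -/
lemma card_oddComps_gadget_le [DecidableRel G.Adj] (hnbr : ∀ v, ∃ w, G.Adj v w) {S T : Finset V}
    {X : Finset ((V × Bool) ⊕ G.Dart)} (hd : Disjoint S T)
    (hS : ∀ p, .inl p ∈ X ↔ p.1 ∈ S) (hT : ∀ d, .inr d ∈ X ↔ d.fst ∈ T) :
    #(oddComps (gadget G) Xᶜ fun _ => 1) ≤
      2 * #T + adjCount G S T + #(oddComps G (S ∪ T)ᶜ fun x => nb G x T) := by
  classical
  let c := compOf (gadget G) Xᶜ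
  let A := (T ×ˢ (univ : Finset Bool)).image fun p => c (.inl p)
  let B := (univ.filter fun d : G.Dart => d.fst ∈ S ∧ d.snd ∈ T).image fun d => c (.inr d)
  let D := (oddComps G (S ∪ T)ᶜ fun x => nb G x T).image (gadgetLift (G := G) S)
  have hA : #A ≤ 2 * #T := card_image_le.trans (by simp [mul_comm])
  have hB : #B ≤ adjCount G S T := card_image_le.trans (card_darts_eq_adjCount S T).le
  have hD : #D ≤ #(oddComps G (S ∪ T)ᶜ fun x => nb G x T) := card_image_le
  suffices hsub : oddComps (gadget G) Xᶜ (fun _ => 1) ⊆ A ∪ B ∪ D by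
    have h1 := card_le_card hsub
    have h2 := card_union_le (A ∪ B) D
    have h3 := card_union_le A B
    omega
  intro K' hK'
  obtain ⟨hc, hodd⟩ := mem_oddComps.1 hK'
  rw [← card_eq_sum_ones] at hodd
  by_cases hKA : K' ∈ A
  · simp [hKA]
  by_cases hKB : K' ∈ B
  · simp [hKB]
  refine mem_union_right _ ?_
  have hlT : ∀ p, .inl p ∈ K' → p.1 ∉ T := fun p hp hpT => hKA
    (mem_image.2 ⟨p, by simpa using hpT, (hc.eq_compOf hp).symm⟩)
  have hlS : ∀ p, .inl p ∈ K' → p.1 ∉ S := fun p hp => by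
    simpa [hS] using hc.1.1 hp
  have hrT : ∀ d, .inr d ∈ K' → d.fst ∉ T := fun d hp => by
    simpa [hT] using hc.1.1 hp
  have hrST : ∀ d, .inr d ∈ K' → d.fst ∈ S → d.snd ∉ T := fun d hp h1 h2 => hKB
    (mem_image.2 ⟨d, by simp [h1, h2], (hc.eq_compOf hp).symm⟩)
  have hsymm : ∀ d : G.Dart, .inr d ∈ K' → d.snd ∉ T → .inr d.symm ∈ K' := fun d hp h =>
    hc.1.2 _ hp _ (by simpa [hT] using h) rfl
  have hfst : ∀ (d : G.Dart) i, .inr d ∈ K' → d.fst ∉ S → .inl (d.fst, i) ∈ K' := fun d i hp h =>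
    hc.1.2 _ hp _ (by simpa [hS] using h) rfl
  have hout : ∀ (d : G.Dart) i, .inl (d.fst, i) ∈ K' → .inr d ∈ K' := fun d i hp =>
    hc.1.2 _ hp _ (by simpa [hT] using hlT _ hp) rfl
  -- A dart inside `S` and its reversal form a component of size two, which is not odd.
  have hrSS : ∀ d, .inr d ∈ K' → d.fst ∈ S → d.snd ∉ S := by
    intro d hp h1 h2
    have hclosed : ClosedIn (gadget G) Xᶜ {.inr d, .inr d.symm} := by
      have hn1 : d.fst ∉ T := Finset.disjoint_left.1 hd h1
      have hn2 : d.snd ∉ T := Finset.disjoint_left.1 hd h2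
      refine ⟨fun x hx => ?_, fun x hx y hy hxy => ?_⟩
      · rcases mem_insert.1 hx with rfl | hx
        · simpa [hT] using hn1
        · rw [mem_singleton.1 hx]
          simpa [hT] using hn2
      · rw [mem_compl] at hy
        rcases mem_insert.1 hx with rfl | hx
        · rcases gadget_adj_inr hxy with rfl | rfl | rfl
          · exact absurd ((hS _).2 h1) hy
          · exact absurd ((hS _).2 h1) hy
          · simp
        · rw [mem_singleton.1 hx] at hxy
          rcases gadget_adj_inr hxy with rfl | rfl | rfl
          · exact absurd ((hS _).2 h2) hy
          · exact absurd ((hS _).2 h2) hy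
          · simp
    have hsub := hc.subset_of_mem hclosed hp (mem_insert_self _ _)
    have heq : K' = {.inr d, .inr d.symm} := by
      refine hsub.antisymm fun x hx => ?_
      rcases mem_insert.1 hx with rfl | hx
      · exact hp
      · rw [mem_singleton.1 hx]
        exact hsymm d hp (Finset.disjoint_left.1 hd h2)
    rw [heq, card_pair (fun h => d.symm_ne (Sum.inr_injective h).symm)] at hodd
    exact absurd hodd (by decide)
  let K : Finset V := univ.filter fun v => .inl (v, false) ∈ K'
  have hmemK : ∀ v i, v ∈ K ↔ .inl (v, i) ∈ K' := by
    -- The two copies of `v` are connected through any dart leaving `v`; hence `hnbr`.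
    have key : ∀ v i j, .inl (v, i) ∈ K' → .inl (v, j) ∈ K' := by
      intro v i j hv
      obtain ⟨w, hw⟩ := hnbr v
      exact hfst ⟨(v, w), hw⟩ j (hout ⟨(v, w), hw⟩ i hv) (hlS _ hv)
    intro v i
    simp only [K, mem_filter, mem_univ, true_and]
    exact ⟨key v _ _, key v _ _⟩
  have hKU : K ⊆ (S ∪ T)ᶜ := fun v hv => by
    rw [hmemK v false] at hv
    simp only [mem_compl, mem_union, not_or]
    exact ⟨hlS _ hv, hlT _ hv⟩
  have hlift : gadgetLift S K = K' := by
    ext x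
    rcases x with ⟨v, i⟩ | d
    · rw [inl_mem_gadgetLift, hmemK v i]
    · rw [inr_mem_gadgetLift, hmemK d.fst false, hmemK d.snd false]
      constructor
      · rintro (h | ⟨hs, h⟩)
        · exact hout d false h
        · simpa using hsymm d.symm (hout d.symm false h) (Finset.disjoint_left.1 hd hs)
      · intro h
        by_cases hs : d.fst ∈ S
        · exact .inr ⟨hs, hfst d.symm false (hsymm d h (hrST d h hs)) (hrSS d h hs)⟩
        · exact .inl (hfst d false h hs)
  have hKcomp : IsComp G (S ∪ T)ᶜ K := by
    refine ⟨⟨hKU, fun u hu v hv huv => ?_⟩, ?_, fun L hLK hne hL => hLK.antisymm fun u hu => ?_⟩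
    · simp only [mem_compl, mem_union, not_or] at hv
      have h1 := hout ⟨(u, v), huv⟩ false ((hmemK u false).1 hu)
      exact (hmemK v false).2 (hfst _ false (hsymm _ h1 hv.2) hv.1)
    · obtain ⟨x, hx⟩ := hc.2.1
      rw [← hlift] at hx
      rcases x with p | d
      · exact ⟨_, inl_mem_gadgetLift.1 hx⟩
      · rcases inr_mem_gadgetLift.1 hx with h | h
        · exact ⟨_, h⟩
        · exact ⟨_, h.2⟩
    · have hLU : ∀ {v}, v ∈ L → v ∉ S ∧ v ∉ T := fun hv => by
        simpa only [mem_compl, mem_union, not_or] using hL.1 hv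
      have hcl : ClosedIn (gadget G) Xᶜ (gadgetLift S L) := by
        refine ⟨fun x hx => ?_, fun x hx y hy hxy => ?_⟩
        · rw [mem_compl]
          rcases x with p | d
          · rw [hS]
            exact (hLU (inl_mem_gadgetLift.1 hx)).1
          · rw [hT]
            rcases inr_mem_gadgetLift.1 hx with h | h
            · exact (hLU h).2
            · exact Finset.disjoint_left.1 hd h.1
        · rw [mem_compl] at hy
          rcases x with p | d
          · rw [inl_mem_gadgetLift] at hx
            rcases y with q | d
            · exact absurd hxy (gadget_adj_inl_inl _ _)
            · rw [gadget_adj_inl_inr] at hxy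
              exact inr_mem_gadgetLift.2 (.inl (hxy ▸ hx))
          · rw [inr_mem_gadgetLift] at hx
            rcases y with q | d'
            · rw [gadget_adj_inr_inl] at hxy
              rw [hS, ← hxy] at hy
              rw [inl_mem_gadgetLift, ← hxy]
              rcases hx with h | h
              · exact h
              · exact absurd h.1 hy
            · obtain rfl : d' = d.symm := hxy
              rw [hT] at hy
              rw [inr_mem_gadgetLift]
              rcases hx with h | h
              · by_cases hs : d.snd ∈ S
                · exact .inr ⟨hs, h⟩
                · exact .inl (hL.2 _ h _ (by
                    simp only [mem_compl, mem_union, not_or]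
                    exact ⟨hs, hy⟩) d.adj)
              · exact .inl h.2
      obtain ⟨v, hv⟩ := hne
      have := hc.subset_of_mem hcl ((hmemK v false).1 (hLK hv)) (inl_mem_gadgetLift.2 hv)
        ((hmemK u false).1 hu)
      exact inl_mem_gadgetLift.1 this
  refine mem_image.2 ⟨K, mem_oddComps.2 ⟨hKcomp, ?_⟩, hlift⟩
  rw [← hKcomp.odd_card_gadgetLift hd, hlift]
  exact hodd

/-- In a smallest violator `X`, counting gives 2|S| + a(T,V) = |X| < 2|T| + a(S,T) + oc(S,T), with a
counting adjacent pairs; cancelling a(S,T) leaves the barrier inequality. -/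
lemma exists_barrier (hnbr : ∀ v, ∃ w, G.Adj v w) (h : ¬ HasTwoFactor G) :
    ∃ S T, IsBarrier G S T := by
  classical
  obtain ⟨X, hX, h3⟩ := exists_minimal_violator (G := gadget G)
    (fun ⟨M, hM⟩ => h (hasTwoFactor_of_gadget hM)) (by
      rw [Fintype.card_sum, Fintype.card_prod, Fintype.card_bool,
        SimpleGraph.dart_card_eq_twice_card_edges]
      simp [parity_simps])
  set c := compOf (gadget G) Xᶜ with hc
  -- A dart has only three neighbours, so all must lie outside `X` and in different components.
  have hdart : ∀ d : G.Dart, .inr d ∈ X → (∀ i, .inl (d.fst, i) ∉ X) ∧ .inr d.symm ∉ X ∧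
      c (.inl (d.fst, false)) ≠ c (.inl (d.fst, true)) := by
    intro d hd
    have key : ∀ a b, ¬ ∀ y, y ∉ X → (gadget G).Adj (.inr d) y → c y ∈ ({c a, c b} : Finset _) :=
      fun a b hab => by
        have h1 := h3 _ hd _ hab
        have h2 := card_le_two (a := c a) (b := c b)
        omega
    have hmem₂ : ∀ a b, c b ∈ ({c a, c b} : Finset _) := fun a b =>
      mem_insert_of_mem (mem_singleton_self _)
    refine ⟨fun i hi => key (.inl (d.fst, !i)) (.inr d.symm) fun y hy hdy => ?_,
      fun hs => key (.inl (d.fst, false)) (.inl (d.fst, true)) fun y hy hdy => ?_,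
      fun he => key (.inl (d.fst, false)) (.inr d.symm) fun y hy hdy => ?_⟩
    · cases i <;> rcases gadget_adj_inr hdy with rfl | rfl | rfl
      · exact absurd hi hy
      · exact mem_insert_self _ _
      · exact hmem₂ _ _
      · exact mem_insert_self _ _
      · exact absurd hi hy
      · exact hmem₂ _ _
    · rcases gadget_adj_inr hdy with rfl | rfl | rfl
      · exact mem_insert_self _ _
      · exact hmem₂ _ _
      · exact absurd hs hy
    · rcases gadget_adj_inr hdy with rfl | rfl | rfl
      · exact mem_insert_self _ _
      · exact mem_insert.2 (.inl he.symm)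
      · exact hmem₂ _ _
  -- Another dart leaving the same vertex, if outside `X`, would join the two copies into one
  -- component.
  have hfst : ∀ d d' : G.Dart, .inr d ∈ X → d'.fst = d.fst → .inr d' ∈ X := by
    intro d d' hd hdd
    by_contra hd'
    obtain ⟨h1, -, h2⟩ := hdart d hd
    have key : ∀ i, c (.inl (d.fst, i)) = c (.inr d') := fun i =>
      compOf_eq_of_adj (mem_compl.2 (h1 i)) (mem_compl.2 hd') hdd
    exact h2 ((key _).trans (key _).symm)
  -- Both copies have the same neighbours, so if one copy is outside `X` the other sees only its
  -- component.
  have hcopy : ∀ v i, .inl (v, i) ∈ X → .inl (v, !i) ∈ X := by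
    intro v i hv
    by_contra hv'
    have := h3 _ hv {c (.inl (v, !i))} fun y hy hvy => by
      rcases y with q | d
      · exact absurd hvy (gadget_adj_inl_inl _ _)
      · rw [mem_singleton]
        exact compOf_eq_of_adj (mem_compl.2 hy) (mem_compl.2 hv') hvy
    rw [card_singleton] at this
    omega
  let S : Finset V := univ.filter fun v => .inl (v, false) ∈ X
  let T : Finset V := univ.filter fun v => ∃ d : G.Dart, d.fst = v ∧ .inr d ∈ X
  have hS : ∀ p, .inl p ∈ X ↔ p.1 ∈ S := by
    rintro ⟨v, i⟩
    simp only [S, mem_filter, mem_univ, true_and]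
    cases i
    · rfl
    · exact ⟨hcopy v true, hcopy v false⟩
  have hT : ∀ d : G.Dart, .inr d ∈ X ↔ d.fst ∈ T := by
    intro d
    simp only [T, mem_filter, mem_univ, true_and]
    exact ⟨fun hd => ⟨d, rfl, hd⟩, fun ⟨d', h1, h2⟩ => hfst d' d h2 h1.symm⟩
  have hd : Disjoint S T := by
    rw [Finset.disjoint_left]
    intro v hvS hvT
    simp only [T, mem_filter, mem_univ, true_and] at hvT
    obtain ⟨d, rfl, hdX⟩ := hvT
    exact (hdart d hdX).1 false ((hS _).2 hvS)
  have hcard : #X = #S * 2 + adjCount G T univ := by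
    have : X = (S ×ˢ univ).disjSum (univ.filter fun d : G.Dart => d.fst ∈ T ∧ d.snd ∈ univ) := by
      ext x
      rcases x with p | d
      · simp [hS]
      · simp [hT]
    rw [this, card_disjSum, card_product, card_darts_eq_adjCount]
    simp
  have hsplit : adjCount G T univ = adjCount G S T + adjCount G T Sᶜ := by
    rw [adjCount_comm S, ← adjCount_union_right disjoint_compl_right, union_compl]
  have := card_oddComps_gadget_le hnbr hd hS hT
  exact ⟨S, T, hd, by omega⟩

/-! ### Translation to `e`, `oc` and induced subgraphs -/

lemma e_eq_zero {X Y : Set V} : e G X Y = 0 ↔ ∀ x ∈ X, ∀ y ∈ Y, ¬ G.Adj x y := by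
  rw [e, Set.ncard_eq_zero]
  refine ⟨fun h x hx y hy hxy => ?_, fun h => Set.eq_empty_iff_forall_notMem.2 ?_⟩
  · exact Set.eq_empty_iff_forall_notMem.1 h s(x, y) ⟨hxy, x, hx, y, hy, rfl⟩
  · rintro _ ⟨h1, x, hx, y, hy, rfl⟩
    exact h x hx y hy h1

/-- Disjointness ensures that only one of the two darts of an edge runs from `X` to `Y`. -/
lemma e_eq_adjCount {X Y : Finset V} (h : Disjoint X Y) : e G X Y = adjCount G X Y := by
  classical
  rw [← card_darts_eq_adjCount, e, ← Set.ncard_coe_finset]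
  symm
  refine Set.ncard_congr (fun d _ => d.edge) (fun d hd => ?_) (fun d d' hd hd' hdd => ?_) ?_
  · simp only [coe_filter, mem_univ, true_and, Set.mem_ofPred_eq] at hd
    exact ⟨d.edge_mem, d.fst, hd.1, d.snd, hd.2, rfl⟩
  · simp only [coe_filter, mem_univ, true_and, Set.mem_ofPred_eq] at hd hd'
    rcases (SimpleGraph.dart_edge_eq_iff d d').1 hdd with h1 | h1
    · exact h1
    · rw [h1] at hd
      exact absurd hd.1 (fun hX => Finset.disjoint_left.1 h hX hd'.2)
  · rintro _ ⟨h1, x, hx, y, hy, rfl⟩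
    exact ⟨⟨(x, y), h1⟩, by simpa using ⟨hx, hy⟩, rfl⟩

lemma e_singleton_eq_nb {x : V} {Y : Finset V} (h : x ∉ Y) : e G {x} Y = nb G x Y := by
  rw [← adjCount_singleton_left, ← e_eq_adjCount (by simpa using h), coe_singleton]

/-- The union of the components of odd weight has exactly those components. -/
lemma isComp_union_odd_iff {U O : Finset V} {g : V → ℕ}
    (hO : ∀ v, v ∈ O ↔ v ∈ U ∧ Odd (∑ x ∈ compOf G U v, g x)) {K : Finset V} :
    IsComp G O K ↔ K ∈ oddComps G U g := by
  have key : ∀ K, K ∈ oddComps G U g → IsComp G O K := fun K hK => by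
    obtain ⟨h1, h2⟩ := mem_oddComps.1 hK
    exact h1.congr (fun x hx => (hO x).2 ⟨h1.1.1 hx, by rwa [← h1.eq_compOf hx]⟩)
      fun x hx y hy => h1.1.2 x hx y ((hO y).1 hy).1
  refine ⟨fun hK => ?_, key K⟩
  obtain ⟨v, hv⟩ := hK.2.1
  obtain ⟨h1, h2⟩ := (hO v).1 (hK.1.1 hv)
  have hmem : compOf G U v ∈ oddComps G U g := mem_oddComps.2 ⟨isComp_compOf h1, h2⟩
  rwa [hK.eq_of_mem (key _ hmem) hv (self_mem_compOf U v)]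

lemma oc_eq_card_oddComps (S T : Finset V) :
    oc G S T = #(oddComps G (S ∪ T)ᶜ fun x => nb G x T) := by
  refine ncard_components_eq_card_oddComps _ (φ := Subtype.val) Subtype.val_injective
    (fun _ _ => Iff.rfl) (fun v => by simp) _ _ fun C K hK => ?_
  have hdis : Disjoint K T := by
    rw [Finset.disjoint_left]
    intro x hx hxT
    rw [← mem_coe, hK] at hx
    obtain ⟨a, -, rfl⟩ := hx
    exact a.2 (.inr hxT)
  rw [verts, ← hK, e_eq_adjCount hdis, adjCount]

lemma exists_equiv_isComp_induce (O : Finset V) :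
    ∃ F : (G.induce (O : Set V)).ConnectedComponent ≃ {K // IsComp G O K},
      ∀ C, ((F C : Finset V) : Set V) = verts C :=
  exists_equiv_isComp _ Subtype.val_injective (fun _ _ => Iff.rfl) fun v => by simp

end GraphFactor

open GraphFactor Finset

theorem lemma3p2 {V : Type*} [Fintype V] (G : SimpleGraph V) [DecidableRel G.Adj]
    (hdeg : ∀ v, 2 ≤ G.degree v) (hG : ¬ GraphFactor.HasTwoFactor G) :
    ∃ S T O R : Set V,
      -- `S`, `T`, `O`, `R` partition the vertex set (some parts may be empty)
      (S ∪ T ∪ O ∪ R = Set.univ ∧ Disjoint S T ∧ Disjoint S O ∧ Disjoint S R ∧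
        Disjoint T O ∧ Disjoint T R ∧ Disjoint O R) ∧
      -- (i)
      G.IsIndepSet T ∧
      -- (ii)
      GraphFactor.e G R (O ∪ T) = 0 ∧
      -- (iii)
      (∀ C : (G.induce O).ConnectedComponent, Odd (GraphFactor.e G (GraphFactor.verts C) T)) ∧
      -- (iv)
      (∀ t ∈ T, ∀ C : (G.induce O).ConnectedComponent,
        GraphFactor.e G {t} (GraphFactor.verts C) ≤ 1) ∧
      -- (v)
      (∀ o ∈ O, GraphFactor.e G {o} T ≤ 1) ∧
      -- (vi)
      (¬ ∃ o ∈ O, ∃ t ∈ T, G.Adj o t ∧ GraphFactor.e G {t} S = 0 ∧ GraphFactor.e G {o} O = 0) ∧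
      -- (vii)
      (T.ncard : ℚ) - (S.ncard : ℚ)
        - ((GraphFactor.e G T O : ℚ) - (GraphFactor.oc G S T : ℚ)) / 2 > 0 ∧
      -- the remark on `oc(S, T)` in (vii)
      GraphFactor.oc G S T = Nat.card (G.induce O).ConnectedComponent := by
  classical
  have hnbr : ∀ v, ∃ w, G.Adj v w := fun v =>
    (G.degree_pos_iff_exists_adj v).1 (zero_lt_two.trans_le (hdeg v))
  obtain ⟨S₀, T₀, h₀⟩ := exists_barrier hnbr hG
  obtain ⟨S, T, hb, hminT, hmaxS, hmin⟩ := exists_extremal_barrier h₀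
  set U := (S ∪ T)ᶜ with hU
  let O : Finset V := U.filter fun v => Odd (∑ x ∈ compOf G U v, nb G x T)
  let R : Finset V := U \ O
  have hO : ∀ v, v ∈ O ↔ v ∈ U ∧ Odd (∑ x ∈ compOf G U v, nb G x T) := fun v => mem_filter
  have hOU : O ⊆ U := filter_subset _ _
  have hOR : U = O ∪ R := (union_sdiff_of_subset hOU).symm
  have hdOR : Disjoint O R := disjoint_sdiff
  have hdU : ∀ v ∈ U, v ∉ S ∧ v ∉ T := fun v hv => by simpa [hU] using hv
  have hdSU : Disjoint S U := Finset.disjoint_right.2 fun v hv => (hdU v hv).1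
  have hdTU : Disjoint T U := Finset.disjoint_right.2 fun v hv => (hdU v hv).2
  have hRU : R ⊆ U := sdiff_subset
  have hcomp : ∀ {K}, IsComp G O K ↔ K ∈ oddComps G U fun x => nb G x T :=
    isComp_union_odd_iff hO
  have hTT : ∀ t ∈ T, ∀ y ∈ T, ¬ G.Adj t y := fun t ht => nb_eq_zero.1 (hb.nb_of_min hminT ht).1
  have hRO : ∀ r ∈ R, ∀ o ∈ O, ¬ G.Adj r o := by
    intro r hr o ho hadj
    obtain ⟨h1, h2⟩ := (hO o).1 ho
    rw [← compOf_eq_of_adj (hRU hr) h1 hadj] at h2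
    exact (mem_sdiff.1 hr).2 ((hO r).2 ⟨hRU hr, h2⟩)
  have hRT : ∀ r ∈ R, ∀ t ∈ T, ¬ G.Adj r t := by
    intro r hr t ht hadj
    have hc := isComp_compOf (G := G) (hRU hr)
    refine nb_eq_zero.1 (((hb.nb_of_min hminT ht).2 _ hc).2 fun hodd => ?_) r
      (self_mem_compOf U r) hadj.symm
    exact (mem_sdiff.1 hr).2 ((hO r).2 ⟨hRU hr, hodd⟩)
  obtain ⟨F, hF⟩ := exists_equiv_isComp_induce (G := G) O
  have hFT : ∀ C, Disjoint (F C : Finset V) T := fun C =>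
    (hdTU.mono_right ((F C).2.1.1.trans hOU)).symm
  have hoc := oc_eq_card_oddComps (G := G) S T
  refine ⟨S, T, O, R, ⟨?_, ?_, ?_, ?_, ?_, ?_, ?_⟩, ?_, ?_, ?_, ?_, ?_, ?_, ?_, ?_⟩
  · rw [Set.union_assoc, ← coe_union O R, ← hOR, ← coe_union, ← coe_union, hU, union_compl,
      coe_univ]
  · exact disjoint_coe.2 hb.1
  · exact disjoint_coe.2 (hdSU.mono_right hOU)
  · exact disjoint_coe.2 (hdSU.mono_right hRU)
  · exact disjoint_coe.2 (hdTU.mono_right hOU)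
  · exact disjoint_coe.2 (hdTU.mono_right hRU)
  · exact disjoint_coe.2 hdOR
  · exact fun t ht y hy _ => hTT t ht y hy
  · rw [e_eq_zero]
    rintro r hr y (hy | hy)
    · exact hRO r hr y hy
    · exact hRT r hr y hy
  · intro C
    rw [← hF, e_eq_adjCount (hFT C)]
    exact (mem_oddComps.1 (hcomp.1 (F C).2)).2
  · intro t ht C
    rw [← hF, e_singleton_eq_nb (Finset.disjoint_right.1 (hFT C) ht)]
    exact ((hb.nb_of_min hminT ht).2 _ (mem_oddComps.1 (hcomp.1 (F C).2)).1).1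
  · intro o ho
    rw [e_singleton_eq_nb (hdU o (hOU ho)).2]
    exact hb.nb_le_one_of_max hmaxS (hOU ho)
  · rintro ⟨o, ho, t, ht, hadj, htS, hoO⟩
    have ho : o ∈ O := ho
    have ht : t ∈ T := ht
    have htS' : t ∉ S := fun h => Finset.disjoint_left.1 hb.1 h ht
    rw [e_singleton_eq_nb htS'] at htS
    rw [e_eq_zero] at hoO
    have h1 : nb G o T = 1 := by
      refine (hb.nb_le_one_of_max hmaxS (hOU ho)).antisymm (Nat.pos_of_ne_zero fun h => ?_)
      exact nb_eq_zero.1 h t ht hadj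
    have h2 : nb G o U = 0 := by
      rw [nb_eq_zero, hOR]
      intro y hy
      rcases mem_union.1 hy with hy | hy
      · exact hoO o rfl y hy
      · exact fun h => hRO y hy o ho h.symm
    -- With no neighbour in `S`, all of the degree of `t` lies outside `S`; here minimum degree 2 is
    -- essential.
    have h3 : 2 ≤ nb G t Sᶜ := by
      have h4 := nb_union (G := G) (x := t) (disjoint_compl_right (a := S))
      rw [union_compl, nb_univ, htS, zero_add] at h4
      rw [← h4]
      exact hdeg t
    exact hb.not_adj_of_extremal hmin (hOU ho) ht h1 h2 h3 (hb.nb_of_min hminT ht).1 hadj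
  · have hgap := hb.2
    rw [adjCount_compl hb.1, ← hU, hOR, adjCount_union_right hdOR, adjCount_eq_zero.2 hTT,
      adjCount_eq_zero.2 fun t ht r hr h => hRT r hr t ht h.symm, ← hOR, hU, ← hoc] at hgap
    rw [e_eq_adjCount (hdTU.mono_right hOU), Set.ncard_coe_finset, Set.ncard_coe_finset]
    have : (2 * #S + (0 + (adjCount G T O + 0)) : ℚ) < 2 * #T + oc G S T := by exact_mod_cast hgap
    linarith
  · rw [hoc, Nat.card_congr F, Nat.card_eq_fintype_card]
    exact (Fintype.card_of_subtype _ fun K => hcomp.symm).symm
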